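/- Let $\mathfrak g$ be a finite-dimensional semisimple Lie algebra over $\mathbb C$ with a fixed Cartan subalgebra $\mathfrak h$ and a fixed set of simple roots, and for a dominant integral weight $\lambda$ let $V(\lambda)$ denote the finite-dimensional simple $\mathfrak g$-module with highest weight $\lambda$. Let $A$ be a nonzero finitely generated commutative $\mathbb C$-algebra, and equip $A\otimes_{\mathbb C}\mathfrak g$ with the Lie bracket $[a\otimes x,b\otimes y]=ab\otimes[x,y]$. For a maximal ideal $\mathfrak m$ of $A$ and $a\in A$, let $a_{\mathfrak m}\in\mathbb C$ be the image of $a$ under $A\to A/\mathfrak m\cong\mathbb C$, and let $V_{\mathfrak m}(\lambda)$ be the evaluation module: the vector space $V(\lambda)$ on which $A\otimes\mathfrak g$ acts by $(a\otimes x)u=a_{\mathfrak m}\,xu$. Let $\mathrm{Ext}^1$ denote the first Yoneda extension group of finite-dimensional $A\otimes\mathfrak g$-modules, i.e. $\mathrm{Ext}^1(V,V')$ is the set of equivalence classes of short exact sequences $0\to V'\to E\to V\to 0$ of finite-dimensional $A\otimes\mathfrak g$-modules, with the Baer sum as addition and with multiplication by $c\in\mathbb C$ given by pulling back along $c\,\mathrm{id}_V$.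 Let $\mathrm{Der}(A,A/\mathfrak m)$ be the $\mathbb C$-vector space of $\mathbb C$-linear derivations of $A$ into the $A$-module $A/\mathfrak m$. Then for every maximal ideal $\mathfrak m$ of $A$ and all dominant integral weights $\lambda,\mu$ there is an isomorphism of $\mathbb C$-vector spaces \[ \mathrm{Ext}^1\bigl(V_{\mathfrak m}(\lambda),V_{\mathfrak m}(\mu)\bigr)\;\cong\;\mathrm{Hom}_{\mathfrak g}\bigl(\mathfrak g\otimes V(\lambda),V(\mu)\bigr)\otimes_{\mathbb C}\mathrm{Der}(A,A/\mathfrak m), \] where $\mathfrak g\otimes V(\lambda)$ is the tensor product of the adjoint module and $V(\lambda)$. -/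

import Mathlib

open scoped TensorProduct

set_option linter.unusedSectionVars false

/-! ### Direct sums of two Lie modules -/

section ProdModule

variable {K L M N : Type*} [CommRing K] [LieRing L] [LieAlgebra K L]
  [AddCommGroup M] [Module K M] [LieRingModule L M] [LieModule K L M]
  [AddCommGroup N] [Module K N] [LieRingModule L N] [LieModule K L N]

/-- The componentwise action of a Lie algebra on the direct sum of two modules. -/
instance LieModule.prodLieRingModule {L M N : Type*} [LieRing L]
    [AddCommGroup M] [LieRingModule L M] [AddCommGroup N] [LieRingModule L N] :
    LieRingModule L (M × N) where
  bracket x z := (⁅x, z.1⁆, ⁅x, z.2⁆)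
  add_lie x y z := Prod.ext (add_lie x y z.1) (add_lie x y z.2)
  lie_add x z z' := Prod.ext (lie_add x z.1 z'.1) (lie_add x z.2 z'.2)
  leibniz_lie x y z := Prod.ext (leibniz_lie x y z.1) (leibniz_lie x y z.2)

theorem LieModule.prod_lie {L M N : Type*} [LieRing L]
    [AddCommGroup M] [LieRingModule L M] [AddCommGroup N] [LieRingModule L N]
    (x : L) (z : M × N) : ⁅x, z⁆ = (⁅x, z.1⁆, ⁅x, z.2⁆) := rfl

instance LieModule.prodLieModule : LieModule K L (M × N) where
  smul_lie t x z := Prod.ext (smul_lie t x z.1) (smul_lie t x z.2)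
  lie_smul t x z := Prod.ext (lie_smul t x z.1) (lie_smul t x z.2)

/-- The fibred product `{(m, n) | f m = g n}` of two homomorphisms of Lie modules, as a submodule
of the direct sum. -/
def LieModuleHom.fibredProduct {Q : Type*} [AddCommGroup Q] [Module K Q] [LieRingModule L Q]
    [LieModule K L Q] (f : M →ₗ⁅K, L⁆ Q) (g : N →ₗ⁅K, L⁆ Q) : LieSubmodule K L (M × N) where
  carrier := {z | f z.1 = g z.2}
  add_mem' {z z'} hz hz' := by
    simp only [Set.mem_ofPred_eq] at hz hz'
    simp [hz, hz']
  zero_mem' := by simp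
  smul_mem' c z hz := by
    simp only [Set.mem_ofPred_eq] at hz
    simp [hz]
  lie_mem {x z} hz := by
    change f z.1 = g z.2 at hz
    change f ⁅x, z.1⁆ = g ⁅x, z.2⁆
    rw [LieModuleHom.map_lie, LieModuleHom.map_lie, hz]

theorem LieModuleHom.mem_fibredProduct {Q : Type*} [AddCommGroup Q] [Module K Q]
    [LieRingModule L Q] [LieModule K L Q] (f : M →ₗ⁅K, L⁆ Q) (g : N →ₗ⁅K, L⁆ Q) (z : M × N) :
    z ∈ f.fibredProduct g ↔ f z.1 = g z.2 := Iff.rfl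

end ProdModule

/-! ### Yoneda extensions of finite-dimensional modules over a Lie algebra -/

universe v w

section Yoneda

variable (K L : Type*) [Field K] [LieRing L] [LieAlgebra K L]
  (V : Type v) [AddCommGroup V] [Module K V] [LieRingModule L V] [LieModule K L V]
  (W : Type w) [AddCommGroup W] [Module K W] [LieRingModule L W] [LieModule K L W]

/-- A short exact sequence `0 → W → E → V → 0` of modules over the Lie algebra `L`, with `E` of
finite dimension over `K`. -/
structure ModuleExtension where
  /-- The middle term. -/
  E : Type (max v w)
  [addCommGroup : AddCommGroup E]
  [module : Module K E]
  [lieRingModule : LieRingModule L E]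
  [lieModule : LieModule K L E]
  [finite : Module.Finite K E]
  /-- The map `W → E`. -/
  incl : W →ₗ⁅K, L⁆ E
  /-- The map `E → V`. -/
  proj : E →ₗ⁅K, L⁆ V
  incl_injective : Function.Injective incl
  exact : ∀ e : E, proj e = 0 ↔ ∃ y : W, incl y = e
  proj_surjective : Function.Surjective proj

namespace ModuleExtension

attribute [instance] ModuleExtension.addCommGroup ModuleExtension.module
  ModuleExtension.lieRingModule ModuleExtension.lieModule ModuleExtension.finite

variable {K L V W}

theorem proj_incl (X : ModuleExtension K L V W) (y : W) : X.proj (X.incl y) = 0 :=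
  (X.exact _).2 ⟨y, rfl⟩

/-- Two extensions are equivalent if there is a homomorphism of modules between the middle terms
that induces the identity on `W` and on `V`. -/
def Equivalent (X Y : ModuleExtension K L V W) : Prop :=
  ∃ ξ : X.E →ₗ⁅K, L⁆ Y.E, (∀ y, ξ (X.incl y) = Y.incl y) ∧ ∀ e, Y.proj (ξ e) = X.proj e

theorem Equivalent.symm {X Y : ModuleExtension K L V W} (h : X.Equivalent Y) :
    Y.Equivalent X := by
  obtain ⟨ξ, h₁, h₂⟩ := h
  have inj : Function.Injective ξ := by
    rw [injective_iff_map_eq_zero]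
    intro e he
    obtain ⟨y, rfl⟩ := (X.exact e).1 (by rw [← h₂, he, map_zero])
    rw [h₁] at he
    rw [Y.incl_injective (he.trans (map_zero _).symm), map_zero]
  have surj : Function.Surjective ξ := by
    intro e
    obtain ⟨e', he'⟩ := X.proj_surjective (Y.proj e)
    obtain ⟨y, hy⟩ := (Y.exact (e - ξ e')).1 (by rw [map_sub, h₂, he', sub_self])
    exact ⟨e' + X.incl y, by rw [map_add, h₁, hy, add_sub_cancel]⟩
  let f : X.E ≃ₗ[K] Y.E := LinearEquiv.ofBijective (ξ : X.E →ₗ[K] Y.E) ⟨inj, surj⟩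
  have hf : ∀ e, f e = ξ e := fun _ => rfl
  have hs : ∀ e, ξ (f.symm e) = e := fun e => f.apply_symm_apply e
  refine ⟨{ f.symm.toLinearMap with map_lie' := ?_ }, ?_, ?_⟩
  · intro x e
    apply inj
    change ξ (f.symm ⁅x, e⁆) = ξ ⁅x, f.symm e⁆
    rw [LieModuleHom.map_lie, hs, hs]
  · intro y
    apply inj
    change ξ (f.symm (Y.incl y)) = ξ (X.incl y)
    rw [hs, h₁]
  · intro e
    change X.proj (f.symm e) = Y.proj e
    rw [← h₂, hs]

/-- Equivalence of extensions, as a setoid. -/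
instance setoid : Setoid (ModuleExtension K L V W) where
  r := Equivalent
  iseqv :=
    { refl := fun _ => ⟨LieModuleHom.id, fun _ => rfl, fun _ => rfl⟩
      symm := Equivalent.symm
      trans := by
        rintro X Y Z ⟨ξ, h₁, h₂⟩ ⟨η, k₁, k₂⟩
        refine ⟨η.comp ξ, fun y => ?_, fun e => ?_⟩
        · rw [LieModuleHom.comp_apply, h₁, k₁]
        · rw [LieModuleHom.comp_apply, k₂, h₂] }

/-- The image of `W` under `y ↦ (i₁ y, -i₂ y)` inside the fibred product of `p₁` and `p₂`. -/
def antidiagonal (X Y : ModuleExtension K L V W) :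
    LieSubmodule K L (X.proj.fibredProduct Y.proj) where
  carrier := {z | ∃ y : W, z.1 = (X.incl y, -Y.incl y)}
  add_mem' := by
    rintro z z' ⟨y, hy⟩ ⟨y', hy'⟩
    refine ⟨y + y', ?_⟩
    change z.1 + z'.1 = _
    rw [hy, hy']
    simp [add_comm]
  zero_mem' := ⟨0, by simp only [map_zero, neg_zero]; rfl⟩
  smul_mem' := by
    rintro c z ⟨y, hy⟩
    refine ⟨c • y, ?_⟩
    change c • z.1 = _
    rw [hy]
    simp
  lie_mem := by
    rintro x z ⟨y, hy⟩
    refine ⟨⁅x, y⁆, ?_⟩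
    change ⁅x, z.1⁆ = _
    rw [hy, LieModule.prod_lie]
    simp

theorem mem_antidiagonal (X Y : ModuleExtension K L V W) (z : X.proj.fibredProduct Y.proj) :
    z ∈ X.antidiagonal Y ↔ ∃ y : W, z.1 = (X.incl y, -Y.incl y) := Iff.rfl

/-- The Baer sum of `0 → W → E₁ → V → 0` and `0 → W → E₂ → V → 0`: the middle term is the quotient
of the fibred product of `p₁` and `p₂` by the image of `y ↦ (i₁ y, -i₂ y)`, the inclusion is
`y ↦ (i₁ y, 0)` and the projection is `(e₁, e₂) ↦ p₁ e₁`. -/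
def baerSum (X Y : ModuleExtension K L V W) : ModuleExtension K L V W where
  E := X.proj.fibredProduct Y.proj ⧸ X.antidiagonal Y
  finite := inferInstanceAs
    (Module.Finite K (X.proj.fibredProduct Y.proj ⧸ (X.antidiagonal Y).toSubmodule))
  incl := (LieSubmodule.Quotient.mk' (X.antidiagonal Y)).comp
    { toFun := fun y => ⟨(X.incl y, 0), by
        rw [LieModuleHom.mem_fibredProduct]; simp [X.proj_incl]⟩
      map_add' := fun y y' => Subtype.ext (by simp)
      map_smul' := fun c y => Subtype.ext (by simp)
      map_lie' := fun {x y} => Subtype.ext (by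
        simp [LieModule.prod_lie]) }
  proj :=
    { (X.antidiagonal Y).toSubmodule.liftQ
        ((X.proj : X.E →ₗ[K] V) ∘ₗ LinearMap.fst K X.E Y.E ∘ₗ
          (X.proj.fibredProduct Y.proj).toSubmodule.subtype)
        (by
          rintro z ⟨y, hy⟩
          change X.proj z.1.1 = 0
          rw [hy]
          exact X.proj_incl y) with
      map_lie' := by
        intro x z
        induction z using Submodule.Quotient.induction_on with
        | H z =>
          change X.proj ⁅x, z.1.1⁆ = ⁅x, X.proj z.1.1⁆
          rw [LieModuleHom.map_lie] }
  incl_injective := by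
    intro y y' h
    have h' := (Submodule.Quotient.eq _).1 h
    obtain ⟨t, ht⟩ := h'
    have h1 : X.incl y - X.incl y' = X.incl t := congrArg Prod.fst ht
    have h2 : (0 : Y.E) - 0 = -Y.incl t := congrArg Prod.snd ht
    have ht0 : t = 0 := Y.incl_injective (by
      rw [map_zero]; simpa using h2.symm)
    rw [ht0, map_zero, sub_eq_zero] at h1
    exact X.incl_injective h1
  exact := by
    intro z
    induction z using Submodule.Quotient.induction_on with
    | H z =>
      constructor
      · intro h
        have h1 : X.proj z.1.1 = 0 := h
        have h2 : Y.proj z.1.2 = 0 := by rw [← (LieModuleHom.mem_fibredProduct _ _ _).1 z.2, h1]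
        obtain ⟨y, hy⟩ := (X.exact _).1 h1
        obtain ⟨y', hy'⟩ := (Y.exact _).1 h2
        refine ⟨y + y', (Submodule.Quotient.eq _).2 ⟨y', Prod.ext ?_ ?_⟩⟩
        · change X.incl (y + y') - z.1.1 = X.incl y'
          rw [← hy, map_add, add_sub_cancel_left]
        · change 0 - z.1.2 = -Y.incl y'
          rw [← hy', zero_sub]
      · rintro ⟨y, hy⟩
        rw [← hy]
        exact X.proj_incl y
  proj_surjective := by
    intro u
    obtain ⟨e, he⟩ := X.proj_surjective u
    obtain ⟨e', he'⟩ := Y.proj_surjective u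
    exact ⟨Submodule.Quotient.mk ⟨(e, e'), he.trans he'.symm⟩, he⟩

theorem baerSum_congr {X X' Y Y' : ModuleExtension K L V W} (h : X.Equivalent X')
    (k : Y.Equivalent Y') : (X.baerSum Y).Equivalent (X'.baerSum Y') := by
  obtain ⟨ξ, h₁, h₂⟩ := h
  obtain ⟨η, k₁, k₂⟩ := k
  let f : X.proj.fibredProduct Y.proj →ₗ[K] X'.proj.fibredProduct Y'.proj :=
    { toFun := fun z => ⟨(ξ z.1.1, η z.1.2), by
        rw [LieModuleHom.mem_fibredProduct, h₂, k₂]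
        exact z.2⟩
      map_add' := fun z z' => Subtype.ext (by simp)
      map_smul' := fun c z => Subtype.ext (by simp) }
  refine ⟨{ (X.antidiagonal Y).toSubmodule.mapQ (X'.antidiagonal Y').toSubmodule f ?_ with
    map_lie' := ?_ }, ?_, ?_⟩
  · rintro z ⟨y, hy⟩
    refine ⟨y, ?_⟩
    change (ξ z.1.1, η z.1.2) = _
    rw [hy]
    simp [h₁, k₁]
  · intro x z
    induction z using Submodule.Quotient.induction_on with
    | H z =>
      refine congrArg Submodule.Quotient.mk (Subtype.ext (Prod.ext ?_ ?_))
      · exact ξ.map_lie x z.1.1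
      · exact η.map_lie x z.1.2
  · intro y
    refine congrArg Submodule.Quotient.mk (Subtype.ext (Prod.ext ?_ ?_))
    · exact h₁ y
    · exact map_zero η
  · intro z
    induction z using Submodule.Quotient.induction_on with
    | H z => exact h₂ z.1.1

/-- The scalar multiple `c • (0 → W → E → V → 0)`: the middle term is the fibred product of
`p : E → V` and `c • id : V → V`, the inclusion is `y ↦ (i y, 0)` and the projection is
`(e, u) ↦ u`. -/
def scalarMul (c : K) (X : ModuleExtension K L V W) :
    ModuleExtension K L V W where
  E := X.proj.fibredProduct (c • (LieModuleHom.id : V →ₗ⁅K, L⁆ V))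
  finite := by
    have : Module.Finite K V :=
      Module.Finite.of_surjective (X.proj : X.E →ₗ[K] V) X.proj_surjective
    infer_instance
  incl :=
    { toFun := fun y => ⟨(X.incl y, 0), by
        rw [LieModuleHom.mem_fibredProduct]; simp [X.proj_incl]⟩
      map_add' := fun y y' => Subtype.ext (by simp)
      map_smul' := fun c y => Subtype.ext (by simp)
      map_lie' := fun {x y} => Subtype.ext (by simp [LieModule.prod_lie]) }
  proj :=
    { toFun := fun z => z.1.2
      map_add' := fun _ _ => rfl
      map_smul' := fun _ _ => rfl
      map_lie' := rfl }
  incl_injective := by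
    intro y y' h
    exact X.incl_injective (congrArg (fun z => z.1.1) h)
  exact := by
    intro z
    constructor
    · intro h
      have h2 : z.1.2 = 0 := h
      have h1 : X.proj z.1.1 = c • z.1.2 := z.2
      rw [h2, smul_zero] at h1
      obtain ⟨y, hy⟩ := (X.exact _).1 h1
      exact ⟨y, Subtype.ext (Prod.ext hy h2.symm)⟩
    · rintro ⟨y, rfl⟩
      rfl
  proj_surjective := by
    intro u
    obtain ⟨e, he⟩ := X.proj_surjective (c • u)
    exact ⟨⟨(e, u), he⟩, rfl⟩

theorem scalarMul_congr (c : K) {X Y : ModuleExtension K L V W}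
    (h : X.Equivalent Y) : (X.scalarMul c).Equivalent (Y.scalarMul c) := by
  obtain ⟨ξ, h₁, h₂⟩ := h
  refine ⟨{
    toFun := fun z => ⟨(ξ z.1.1, z.1.2), (h₂ z.1.1).trans z.2⟩
    map_add' := fun z z' => Subtype.ext (Prod.ext (map_add ξ z.1.1 z'.1.1) rfl)
    map_smul' := fun a z => Subtype.ext (Prod.ext (map_smul ξ a z.1.1) rfl)
    map_lie' := fun {x z} => Subtype.ext (Prod.ext (ξ.map_lie x z.1.1) rfl) }, ?_, ?_⟩
  · exact fun y => Subtype.ext (Prod.ext (h₁ y) rfl)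
  · exact fun _ => rfl

end ModuleExtension

/-- `Ext¹(V, W)`: equivalence classes of short exact sequences `0 → W → E → V → 0` of
finite-dimensional modules over the Lie algebra `L`. -/
def YonedaExt : Type _ := Quotient (ModuleExtension.setoid (K := K) (L := L) (V := V) (W := W))

namespace YonedaExt

/-- Addition in `Ext¹` is the Baer sum. -/
instance : Add (YonedaExt K L V W) where
  add := Quotient.map₂ ModuleExtension.baerSum
    fun _ _ h _ _ k => ModuleExtension.baerSum_congr h k

/-- The multiplication by scalars in `Ext¹`. -/
instance : SMul K (YonedaExt K L V W) where
  smul c := Quotient.map (ModuleExtension.scalarMul c)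
    fun _ _ h => ModuleExtension.scalarMul_congr c h

end YonedaExt

end Yoneda

/-! ### Evaluation modules -/

section Evaluation

variable {A : Type*} [CommRing A] [Algebra ℂ A] [Algebra.FiniteType ℂ A]

theorem algebraMap_quotient_bijective (m : Ideal A) [hm : m.IsMaximal] :
    Function.Bijective (algebraMap ℂ (A ⧸ m)) := by
  let _ := Ideal.Quotient.field m
  have : Algebra.FiniteType ℂ (A ⧸ m) :=
    Algebra.FiniteType.of_surjective (Ideal.Quotient.mkₐ ℂ m) Ideal.Quotient.mk_surjective
  have : Module.Finite ℂ (A ⧸ m) := finite_of_finite_type_of_isJacobsonRing ℂ (A ⧸ m)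
  exact IsAlgClosed.algebraMap_bijective_of_isIntegral

/-- The map `a ↦ a_m`, the natural projection `A → A / m` followed by the inverse of the
canonical isomorphism `ℂ ≃ A / m`. -/
noncomputable def residue (m : Ideal A) [m.IsMaximal] : A →ₐ[ℂ] ℂ :=
  (AlgEquiv.ofBijective (Algebra.ofId ℂ (A ⧸ m))
    (algebraMap_quotient_bijective m)).symm.toAlgHom.comp (Ideal.Quotient.mkₐ ℂ m)

variable (𝔤 : Type*) [LieRing 𝔤] [LieAlgebra ℂ 𝔤]

/-- The evaluation homomorphism `A ⊗ 𝔤 → 𝔤`, `a ⊗ x ↦ a_m x`. -/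
noncomputable def evalHom (m : Ideal A) [m.IsMaximal] : A ⊗[ℂ] 𝔤 →ₗ⁅ℂ⁆ 𝔤 :=
  { TensorProduct.lift ((LinearMap.lsmul ℂ 𝔤).comp (residue m).toLinearMap) with
    map_lie' := by
      intro y z
      change TensorProduct.lift ((LinearMap.lsmul ℂ 𝔤).comp (residue m).toLinearMap) ⁅y, z⁆ =
        ⁅TensorProduct.lift ((LinearMap.lsmul ℂ 𝔤).comp (residue m).toLinearMap) y,
          TensorProduct.lift ((LinearMap.lsmul ℂ 𝔤).comp (residue m).toLinearMap) z⁆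
      induction y using TensorProduct.induction_on with
      | zero => simp
      | add y₁ y₂ h₁ h₂ => rw [add_lie, map_add, map_add, add_lie, h₁, h₂]
      | tmul a x =>
        induction z using TensorProduct.induction_on with
        | zero => simp
        | add z₁ z₂ h₁ h₂ => rw [lie_add, map_add, map_add, lie_add, h₁, h₂]
        | tmul b y => 
          rw [LieAlgebra.ExtendScalars.bracket_tmul]
          simp [mul_smul, smul_comm (residue m a) (residue m b)] }

theorem evalHom_tmul (m : Ideal A) [m.IsMaximal] (a : A) (x : 𝔤) :
    evalHom 𝔤 m (a ⊗ₜ x) = residue m a • x := rfl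

/-- The evaluation module `ev_m^* V`: the vector space `V`, on which `A ⊗ 𝔤` acts through
`ev_m : A ⊗ 𝔤 → 𝔤`. -/
def EvaluationModule (_m : Ideal A) (V : Type*) : Type _ := V

variable (m : Ideal A) (V : Type*) [AddCommGroup V] [Module ℂ V]

instance : AddCommGroup (EvaluationModule m V) := inferInstanceAs (AddCommGroup V)

instance : Module ℂ (EvaluationModule m V) := inferInstanceAs (Module ℂ V)

variable [m.IsMaximal] [LieRingModule 𝔤 V] [LieModule ℂ 𝔤 V]

noncomputable instance : LieRingModule (A ⊗[ℂ] 𝔤) (EvaluationModule m V) :=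
  LieRingModule.compLieHom V (evalHom 𝔤 m)

instance : LieModule ℂ (A ⊗[ℂ] 𝔤) (EvaluationModule m V) :=
  LieModule.compLieHom V (evalHom 𝔤 m)

theorem EvaluationModule.tmul_lie (a : A) (x : 𝔤) (u : V) :
    (⁅a ⊗ₜ[ℂ] x, (show EvaluationModule m V from u)⁆ : EvaluationModule m V) =
      (show EvaluationModule m V from residue m a • ⁅x, u⁆) := by
  change ⁅residue m a • x, u⁆ = _
  rw [smul_lie]

end Evaluation

/-! ### Dominant weights and simple highest weight modules -/

section HighestWeight

open LieAlgebra LieAlgebra.IsKilling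

variable {𝔤 : Type*} [LieRing 𝔤] [LieAlgebra ℂ 𝔤] [Module.Finite ℂ 𝔤]
  [LieAlgebra.IsSemisimple ℂ 𝔤] {H : LieSubalgebra ℂ 𝔤} [H.IsCartanSubalgebra]

/-- A linear form `lam` on the Cartan subalgebra is a dominant (integral) weight if its value on
every simple coroot is a nonnegative integer. -/
def IsDominantWeight (b : (rootSystem H).Base) (lam : Module.Dual ℂ H) : Prop :=
  ∀ i ∈ b.support, ∃ n : ℕ, lam ((rootSystem H).coroot i) = n

/-- `V` is the finite-dimensional simple `𝔤`-module `V(lam)` with highest weight `lam`: it is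
finite-dimensional, simple, and contains a nonzero vector of weight `lam` that is annihilated by
all root spaces of positive roots. -/
structure IsSimpleOfHighestWeight (b : (rootSystem H).Base) (lam : Module.Dual ℂ H)
    (V : Type*) [AddCommGroup V] [Module ℂ V] [LieRingModule 𝔤 V] [LieModule ℂ 𝔤 V] : Prop where
  finite : Module.Finite ℂ V
  irreducible : LieModule.IsIrreducible ℂ 𝔤 V
  exists_highestWeightVector : ∃ u : V, u ≠ 0 ∧
    (∀ h : H, ⁅(h : 𝔤), u⁆ = lam h • u) ∧
    ∀ α : H.root, b.IsPos α → ∀ x ∈ rootSpace H α.1, ⁅x, u⁆ = 0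

end HighestWeight

/-! ### The first Whitehead lemma -/

section Whitehead

open LieModule Module

attribute [local instance] LieRing.ofAssociativeRing

/-! An extension of `V` by `W` splits as a sequence of vector spaces, so Ext¹ is the space of
1-cocycles of `A ⊗ 𝔤` in `Hom(V, W)` modulo coboundaries (`YonedaExt.ofCocycle_eq_iff`,
`YonedaExt.ofCocycle_surjective`). By Whitehead's first lemma, proved here with a Casimir operator,
the restriction of a cocycle to `1 ⊗ 𝔤` is a coboundary, so every class has a representative `f`
that vanishes on `1 ⊗ 𝔤`. For such `f` the cocycle identity at `(1 ⊗ x, a ⊗ y)` says that `f(a ⊗ ·)`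
is 𝔤-equivariant, that is, an element `F(a)` of `Hom_𝔤(𝔤 ⊗ V, W)`. The general identity then becomes
`F(ab) = a_m F(b) + b_m F(a)` on brackets, hence everywhere because `𝔤 = [𝔤, 𝔤]`. So `F` is a
derivation with values in a finite-dimensional space, that is, an element of `Hom_𝔤(𝔤 ⊗ V, W) ⊗
Der(A, A/m)`; conversely each such element gives a cocycle. The normalised representative is unique:
both modules are evaluated at the same point, so a coboundary that vanishes on `1 ⊗ 𝔤` vanishes on
`A ⊗ 𝔤`. -/

theorem LieAlgebra.HasTrivialRadical.derivedSeries_one_eq_top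
    {K L : Type*} [Field K] [CharZero K] [LieRing L] [LieAlgebra K L] [Module.Finite K L]
    [LieAlgebra.HasTrivialRadical K L] : LieAlgebra.derivedSeries K L 1 = ⊤ := by
  have hc := LieIdeal.isCompl_killingCompl (LieAlgebra.derivedSeries K L 1)
  -- The Killing complement `C` of `[L, L]` satisfies `[C, C] ⊆ C ∩ [L, L] = 0`, and an abelian
  -- ideal is zero.
  have : IsLieAbelian (LieAlgebra.derivedSeries K L 1).killingCompl := by
    rw [LieSubmodule.lie_abelian_iff_lie_self_eq_bot, eq_bot_iff, ← hc.inf_eq_bot]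
    refine le_inf ?_ (LieSubmodule.lie_le_left _ _)
    exact LieSubmodule.mono_lie le_top le_top
  have h := LieAlgebra.IsKilling.ideal_eq_bot_of_isLieAbelian
    (LieAlgebra.derivedSeries K L 1).killingCompl
  have htop := hc.sup_eq_top
  rwa [h, sup_bot_eq] at htop

/-- A linear map on a semisimple Lie algebra that vanishes on brackets is zero. -/
theorem LieAlgebra.HasTrivialRadical.linearMap_eq_zero_of_lie
    {K L M : Type*} [Field K] [CharZero K] [LieRing L] [LieAlgebra K L] [Module.Finite K L]
    [LieAlgebra.HasTrivialRadical K L] [AddCommGroup M] [Module K M] (f : L →ₗ[K] M)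
    (h : ∀ x y : L, f ⁅x, y⁆ = 0) : f = 0 := by
  rw [← LinearMap.ker_eq_top, eq_top_iff, ← LieSubmodule.top_toSubmodule (R := K) (L := L) (M := L),
    ← derivedSeries_one_eq_top]
  refine (LieAlgebra.coe_derivedSeries_one_eq K L).le.trans (Submodule.span_le.2 ?_)
  rintro _ ⟨x, y, rfl⟩
  exact h x y

variable {K L M : Type*} [Field K] [LieRing L] [LieAlgebra K L]
  [AddCommGroup M] [Module K M] [LieRingModule L M] [LieModule K L M]

/-- The invariance of the canonical tensor `∑ eᵢ ⊗ dᵢ` of a pair of dual bases. -/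
theorem LinearMap.sum_lie_add_sum_lie_eq_zero_of_dual {ι : Type*} [Fintype ι]
    {e d : ι → L} {x : L} (a : ι → ι → K) (he : ∀ i, ⁅x, e i⁆ = ∑ j, a i j • e j)
    (hd : ∀ i, ⁅x, d i⁆ = -∑ j, a j i • d j) {N : Type*} [AddCommGroup N] [Module K N]
    (B : L →ₗ[K] L →ₗ[K] N) :
    ∑ i, (B ⁅x, e i⁆ (d i) + B (e i) ⁅x, d i⁆) = 0 := by
  simp only [he, hd, map_sum, map_smul, map_neg, LinearMap.sum_apply, LinearMap.smul_apply,
    Finset.sum_add_distrib, Finset.sum_neg_distrib]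
  -- The two double sums are `∑ a i j • B (e j) (d i)` and its negative with `i` and `j` exchanged.
  rw [Finset.sum_comm, add_neg_cancel]

/-- Cartan's criterion: on the radical `I` of the trace form, `[I, I]` acts nilpotently and so kills
a nonzero vector. The vectors it kills form an `L`-submodule, hence all of `M`, and `[I, I]` lies in
the kernel of the representation. Therefore `I` meets the Killing complement of that kernel in an
abelian ideal, which is zero. -/
theorem LieModule.eq_zero_of_mem_killingCompl_ker_of_traceForm_eq_zero [CharZero K]
    [Module.Finite K L] [Module.Finite K M] [LieAlgebra.HasTrivialRadical K L]
    [LieModule.IsIrreducible K L M] {x : L}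
    (hx : x ∈ (toEnd K L M).ker.killingCompl) (h : ∀ y, traceForm K L M x y = 0) : x = 0 := by
  have := nontrivial_of_isIrreducible K L M
  let I : LieIdeal K L :=
    { LinearMap.ker (traceForm K L M) with
      lie_mem := by
        intro y z hz
        change traceForm K L M ⁅y, z⁆ = 0
        change traceForm K L M z = 0 at hz
        ext t
        rw [← lie_skew, map_neg, LinearMap.neg_apply, traceForm_apply_lie_apply, hz]
        simp }
  have hI : traceForm K I M = 0 := by
    ext ⟨y, hy⟩ ⟨z, hz⟩
    exact LinearMap.congr_fun (show traceForm K L M y = 0 from hy) z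
  have hnil := isNilpotent_derivedSeries_of_traceForm_eq_zero hI
  have hfix : Nontrivial (maxTrivSubmodule K (LieAlgebra.derivedSeries K I 1) M) :=
    nontrivial_max_triv_of_isNilpotent K _ M
  let N : LieSubmodule K L M :=
    { carrier := {u | ∀ y ∈ ⁅I, I⁆, ⁅y, u⁆ = 0}
      add_mem' := fun hu hv y hy => by rw [lie_add, hu y hy, hv y hy, add_zero]
      zero_mem' := fun y _ => lie_zero y
      smul_mem' := fun c u hu y hy => by rw [lie_smul, hu y hy, smul_zero]
      lie_mem := by
        intro z u hu y hy
        rw [leibniz_lie, hu y hy, lie_zero, add_zero]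
        exact hu _ (lie_mem_left K L ⁅I, I⁆ y z hy) }
  have hN : N = ⊤ := by
    have : Nontrivial N := by
      obtain ⟨⟨u, hu⟩, hu0⟩ := exists_ne (0 : maxTrivSubmodule K (LieAlgebra.derivedSeries K I 1) M)
      refine ⟨⟨⟨u, fun y hy => ?_⟩, 0, fun h => hu0 (Subtype.ext ?_)⟩⟩
      swap
      · exact congrArg (Subtype.val : N → M) h
      have hyI : y ∈ I := LieSubmodule.lie_le_left _ _ hy
      refine hu ⟨⟨y, hyI⟩, ?_⟩
      -- Passes from the derived algebra of `I` as a Lie algebra to the ideal `⁅I, I⁆` of `L`.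
      rw [LieIdeal.derivedSeries_eq_derivedSeriesOfIdeal_comap, LieIdeal.mem_comap]
      exact hy
    exact N.eq_top_of_isIrreducible K L M
  have hker : ⁅I, I⁆ ≤ (toEnd K L M).ker := by
    intro y hy
    rw [LieHom.mem_ker]
    ext u
    exact (hN ▸ LieSubmodule.mem_top u : u ∈ N) y hy
  have hc := LieIdeal.isCompl_killingCompl (toEnd K L M).ker
  have hab : IsLieAbelian (I ⊓ (toEnd K L M).ker.killingCompl : LieIdeal K L) := by
    rw [LieSubmodule.lie_abelian_iff_lie_self_eq_bot, eq_bot_iff, ← hc.inf_eq_bot]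
    exact le_inf ((LieSubmodule.mono_lie inf_le_left inf_le_left).trans hker)
      ((LieSubmodule.lie_le_left _ _).trans inf_le_right)
  have hbot := LieAlgebra.IsKilling.ideal_eq_bot_of_isLieAbelian
    (I ⊓ (toEnd K L M).ker.killingCompl)
  have hxI : x ∈ I := by
    change traceForm K L M x = 0
    ext y
    exact h y
  have hxm : x ∈ I ⊓ (toEnd K L M).ker.killingCompl := ⟨hxI, hx⟩
  rwa [hbot, LieSubmodule.mem_bot] at hxm

/-- There are dual bases, with respect to the trace form, of a complement of the kernel of an
irreducible representation; the complement is an ideal, and it is zero only if the representation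
is trivial. -/
theorem LieModule.exists_dual_bases [CharZero K]
    [Module.Finite K L] [Module.Finite K M] [LieAlgebra.HasTrivialRadical K L]
    [LieModule.IsIrreducible K L M] :
    ∃ (n : ℕ) (e d : Fin n → L),
      (n = 0 → ∀ (x : L) (u : M), ⁅x, u⁆ = 0) ∧
      (∀ i, traceForm K L M (e i) (d i) = 1) ∧
      ∀ x : L, ∃ a : Fin n → Fin n → K, (∀ i, ⁅x, e i⁆ = ∑ j, a i j • e j) ∧
        ∀ i, ⁅x, d i⁆ = -∑ j, a j i • d j := by
  set P := (toEnd K L M).ker.killingCompl with hP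
  have hc := LieIdeal.isCompl_killingCompl (toEnd K L M).ker
  let β : LinearMap.BilinForm K P := traceForm K P M
  have hβapp : ∀ x y : P, β x y = traceForm K L M x y := fun _ _ => rfl
  have hsymm : β.IsSymm := ⟨fun x y => traceForm_comm K P M x y⟩
  have hβ : β.Nondegenerate := by
    refine hsymm.isRefl.nondegenerate_iff_separatingLeft.mpr fun x hx => ?_
    refine Subtype.ext (eq_zero_of_mem_killingCompl_ker_of_traceForm_eq_zero (M := M)
      x.2 fun y => ?_)
    -- The component of `y` in the kernel acts by zero, so orthogonality to `P` gives orthogonality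
    -- to all of `L`.
    obtain ⟨z, hz, w, hw, rfl⟩ : ∃ z ∈ (toEnd K L M).ker, ∃ w ∈ P, z + w = y := by
      rw [← LieSubmodule.mem_sup, hc.sup_eq_top]
      trivial
    rw [map_add, ← hβapp x ⟨w, hw⟩, hx, add_zero, traceForm_apply_apply,
      LieHom.mem_ker.1 hz, LinearMap.comp_zero, map_zero]
  let b := Module.finBasis K P
  let b' := LinearMap.BilinForm.dualBasis β hβ b
  have hb' : ∀ i j, β (b' i) (b j) = if j = i then 1 else 0 :=
    LinearMap.BilinForm.apply_dualBasis_left hβ b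
  have exp_b : ∀ z : P, z = ∑ j, β z (b' j) • b j := by
    intro z
    conv_lhs => rw [← b.sum_repr z]
    refine Finset.sum_congr rfl fun j _ => ?_
    have : β (b' j) (∑ i, b.repr z i • b i) = b.repr z j := by
      simp only [map_sum, map_smul, hb', smul_eq_mul]
      simp
    rw [← this, b.sum_repr, hsymm.eq]
  have exp_b' : ∀ z : P, z = ∑ j, β z (b j) • b' j := by
    intro z
    conv_lhs => rw [← b'.sum_repr z]
    refine Finset.sum_congr rfl fun j _ => ?_
    have : β (∑ i, b'.repr z i • b' i) (b j) = b'.repr z j := by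
      simp only [map_sum, map_smul, LinearMap.sum_apply, LinearMap.smul_apply, hb', smul_eq_mul]
      simp
    rw [← this, b'.sum_repr]
  refine ⟨finrank K P, fun i => b i, fun i => b' i, ?_, ?_, ?_⟩
  · intro h x u
    have hPbot : P = ⊥ := by
      rw [← LieSubmodule.toSubmodule_eq_bot]
      exact Submodule.finrank_eq_zero.1 h
    have : (toEnd K L M).ker = ⊤ := by simpa [← hP, hPbot] using hc.sup_eq_top
    have hx : x ∈ (toEnd K L M).ker := this ▸ LieSubmodule.mem_top x
    exact LinearMap.congr_fun (LieHom.mem_ker.1 hx) u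
  · intro i
    rw [traceForm_comm, ← hβapp, hb', if_pos rfl]
  · intro x
    have hinv : ∀ y z : P, β ⁅x, y⁆ z = -β y ⁅x, z⁆ := by
      intro y z
      exact traceForm_lieInvariant K L M x y z
    -- The matrix of `ad x` in the basis `b`; invariance of the form makes its matrix in the dual
    -- basis the negative transpose.
    refine ⟨fun i j => β ⁅x, b i⁆ (b' j), fun i => ?_, fun i => ?_⟩
    · have := congrArg Subtype.val (exp_b ⁅x, b i⁆)
      simpa using this
    · have := congrArg Subtype.val (exp_b' ⁅x, b' i⁆)
      simp only [hinv (b _)]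
      simpa [hsymm.eq ⁅x, b' i⁆] using this

/-- The first Whitehead lemma for irreducible modules. -/
theorem LieModule.exists_lie_eq_of_isIrreducible [CharZero K]
    [Module.Finite K L] [Module.Finite K M] [LieAlgebra.HasTrivialRadical K L]
    [LieModule.IsIrreducible K L M] (f : L →ₗ[K] M)
    (hf : ∀ x y, f ⁅x, y⁆ = ⁅x, f y⁆ - ⁅y, f x⁆) : ∃ u : M, ∀ x, f x = ⁅x, u⁆ := by
  obtain ⟨n, e, d, h0, h1, hinv⟩ := exists_dual_bases (K := K) (L := L) (M := M)
  rcases Nat.eq_zero_or_pos n with hn | hn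
  · refine ⟨0, fun x => ?_⟩
    have : f = 0 := LieAlgebra.HasTrivialRadical.linearMap_eq_zero_of_lie f fun x y => by
      rw [hf, h0 hn, h0 hn, sub_zero]
    rw [this, lie_zero, LinearMap.zero_apply]
  -- The Casimir operator. It commutes with `L` and has trace `n ≠ 0`, each summand having trace 1;
  -- so its kernel, a submodule, is zero.
  let c : Module.End K M := ∑ i, toEnd K L M (e i) * toEnd K L M (d i)
  have hc : ∀ u, c u = ∑ i, ⁅e i, ⁅d i, u⁆⁆ := fun u => by simp [c]
  have htr : LinearMap.trace K M c = n := by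
    have : ∀ i, LinearMap.trace K M (toEnd K L M (e i) * toEnd K L M (d i)) = 1 := h1
    simp [c, map_sum, this]
  have hcomm : ∀ (x : L) (u : M), ⁅x, c u⁆ = c ⁅x, u⁆ := by
    intro x u
    obtain ⟨a, ha, ha'⟩ := hinv x
    let B : L →ₗ[K] L →ₗ[K] M := LinearMap.mk₂ K (fun y z => ⁅y, ⁅z, u⁆⁆)
      (by simp) (by simp) (by simp) (by simp)
    have h := LinearMap.sum_lie_add_sum_lie_eq_zero_of_dual a ha ha' B
    simp only [B, LinearMap.mk₂_apply] at h
    rw [hc, hc, lie_sum, ← sub_eq_zero, ← Finset.sum_sub_distrib, ← h]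
    refine Finset.sum_congr rfl fun i _ => ?_
    rw [leibniz_lie x (e i), leibniz_lie x (d i), lie_add]
    abel
  have hinj : Function.Injective c := by
    let N : LieSubmodule K L M :=
      { LinearMap.ker c with
        lie_mem := by
          intro x u hu
          change c u = 0 at hu
          change c ⁅x, u⁆ = 0
          rw [← hcomm, hu, lie_zero] }
    rw [← LinearMap.ker_eq_bot]
    by_contra hN
    have : Nontrivial N := (Submodule.nontrivial_iff_ne_bot (p := LinearMap.ker c)).2 hN
    have hN' := N.eq_top_of_isIrreducible K L M
    have hc0 : c = 0 := by
      ext u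
      exact (hN' ▸ LieSubmodule.mem_top u : u ∈ N)
    rw [hc0, map_zero] at htr
    exact hn.ne' (by exact_mod_cast htr.symm)
  -- If `f x = ⁅x, u⁆`, then `c u = ∑ ⁅e i, f (d i)⁆`, which determines `u`. Conversely, invariance
  -- applied to `B y z = ⁅y, f z⁆` gives `c (f x) = ⁅x, c u⁆`.
  obtain ⟨u, hu⟩ := (LinearMap.injective_iff_surjective.1 hinj) (∑ i, ⁅e i, f (d i)⁆)
  refine ⟨u, fun x => hinj ?_⟩
  obtain ⟨a, ha, ha'⟩ := hinv x
  let B : L →ₗ[K] L →ₗ[K] M := LinearMap.mk₂ K (fun y z => ⁅y, f z⁆)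
    (by simp) (by simp) (by simp) (by simp)
  have h := LinearMap.sum_lie_add_sum_lie_eq_zero_of_dual a ha ha' B
  simp only [B, LinearMap.mk₂_apply] at h
  rw [← hcomm, hu, hc, lie_sum, eq_comm, ← sub_eq_zero, ← Finset.sum_sub_distrib, ← h]
  refine Finset.sum_congr rfl fun i _ => ?_
  rw [leibniz_lie x (e i), hf, lie_sub]
  abel

/-- The first Whitehead lemma. -/
theorem LieModule.exists_lie_eq_of_cocycle [CharZero K]
    [Module.Finite K L] [LieAlgebra.HasTrivialRadical K L] [Module.Finite K M] (f : L →ₗ[K] M)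
    (hf : ∀ x y, f ⁅x, y⁆ = ⁅x, f y⁆ - ⁅y, f x⁆) : ∃ u : M, ∀ x, f x = ⁅x, u⁆ := by
  induction hn : finrank K M using Nat.strong_induction_on generalizing M with
  | _ n ih =>
  subst hn
  rcases subsingleton_or_nontrivial M with hM | hM
  · exact ⟨0, fun x => Subsingleton.elim _ _⟩
  by_cases hirr : ∀ N : LieSubmodule K L M, N ≠ ⊥ → N = ⊤
  · have := LieModule.IsIrreducible.mk hirr
    exact exists_lie_eq_of_isIrreducible f hf
  push Not at hirr
  obtain ⟨N, hbot, htop⟩ := hirr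
  have hlt : finrank K N < finrank K M :=
    Submodule.finrank_lt (s := N.toSubmodule) (by simpa using htop)
  have hlt' : finrank K (M ⧸ N) < finrank K M := by
    have h1 := N.toSubmodule.finrank_quotient_add_finrank
    have h2 : 0 < finrank K N.toSubmodule := by
      have : Nontrivial N.toSubmodule :=
        (Submodule.nontrivial_iff_ne_bot).2 (by simpa using hbot)
      exact finrank_pos
    change finrank K (M ⧸ N.toSubmodule) < _
    omega
  have : Module.Finite K (M ⧸ N) := inferInstanceAs (Module.Finite K (M ⧸ N.toSubmodule))
  -- After solving in `M ⧸ N` and lifting the solution to `u`, the cocycle `f x - ⁅x, u⁆` takes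
  -- values in `N`, where induction applies again.
  obtain ⟨u', hu'⟩ := ih _ hlt' ((LieSubmodule.Quotient.mk' N : M →ₗ[K] M ⧸ N).comp f)
    (fun x y => by simp only [LinearMap.comp_apply, hf, map_sub]; rfl) rfl
  obtain ⟨u, rfl⟩ := LieSubmodule.Quotient.surjective_mk' N u'
  have hmem : ∀ x, f x - ⁅x, u⁆ ∈ N := by
    intro x
    rw [← LieSubmodule.Quotient.mk_eq_zero, map_sub, LieModuleHom.map_lie, sub_eq_zero]
    exact hu' x
  let g : L →ₗ[K] N :=
    { toFun := fun x => ⟨f x - ⁅x, u⁆, hmem x⟩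
      map_add' := fun x y => Subtype.ext (by simp; abel)
      map_smul' := fun t x => Subtype.ext (by simp [smul_sub]) }
  obtain ⟨v, hv⟩ := ih _ hlt g (fun x y => Subtype.ext (by
    simp only [g, LinearMap.coe_mk, AddHom.coe_mk, LieSubmodule.coe_sub, LieSubmodule.coe_bracket,
      hf, lie_sub, lie_lie]
    abel)) rfl
  refine ⟨u + v, fun x => ?_⟩
  have := congrArg Subtype.val (hv x)
  simp only [g, LinearMap.coe_mk, AddHom.coe_mk, LieSubmodule.coe_bracket] at this
  rw [lie_add, ← this]
  abel

end Whitehead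

/-! ### Extensions and cocycles -/

section Cocycle

variable (K L : Type*) [Field K] [LieRing L] [LieAlgebra K L]
  (V : Type v) [AddCommGroup V] [Module K V] [LieRingModule L V] [LieModule K L V]
  (W : Type w) [AddCommGroup W] [Module K W] [LieRingModule L W] [LieModule K L W]

/-- The 1-cocycles of `L` with values in `Hom(V, W)`. -/
def LieModule.homCocycle : Submodule K (L →ₗ[K] V →ₗ[K] W) where
  carrier := {f | ∀ x y : L, f ⁅x, y⁆ = ⁅x, f y⁆ - ⁅y, f x⁆}
  add_mem' {f g} hf hg x y := by
    simp only [LinearMap.add_apply, lie_add, hf x y, hg x y]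
    abel
  zero_mem' x y := by simp
  smul_mem' c f hf x y := by
    simp only [LinearMap.smul_apply, lie_smul, hf x y, smul_sub]

variable {K L V W}

theorem LieModule.homCocycle.lie_apply (f : LieModule.homCocycle K L V W) (x y : L) (u : V) :
    f.1 ⁅x, y⁆ u = ⁅x, f.1 y u⁆ - f.1 y ⁅x, u⁆ - (⁅y, f.1 x u⁆ - f.1 x ⁅y, u⁆) := by
  rw [f.2 x y]
  simp [LieHom.lie_apply]

/-- The vector space `W × V` with the action `x (w, u) = (x w + f(x) u, x u)` of `L` that is
twisted by the cocycle `f`. -/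
def CocycleModule (_f : LieModule.homCocycle K L V W) : Type (max v w) := W × V

namespace CocycleModule

variable (f : LieModule.homCocycle K L V W)

instance : AddCommGroup (CocycleModule f) := inferInstanceAs (AddCommGroup (W × V))

instance : Module K (CocycleModule f) := inferInstanceAs (Module K (W × V))

instance [Module.Finite K V] [Module.Finite K W] : Module.Finite K (CocycleModule f) :=
  inferInstanceAs (Module.Finite K (W × V))

/-- The first component of the Leibniz rule is the cocycle identity for `f`. -/
instance : LieRingModule L (CocycleModule f) where
  bracket x z := ((⁅x, z.1⁆ + f.1 x z.2, ⁅x, z.2⁆) : W × V)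
  add_lie x y z := Prod.ext
    (by
      change ⁅x + y, z.1⁆ + f.1 (x + y) z.2 = (⁅x, z.1⁆ + f.1 x z.2) + (⁅y, z.1⁆ + f.1 y z.2)
      rw [add_lie, map_add, LinearMap.add_apply]
      abel)
    (add_lie x y z.2)
  lie_add x z z' := Prod.ext
    (by
      change ⁅x, z.1 + z'.1⁆ + f.1 x (z.2 + z'.2) =
        (⁅x, z.1⁆ + f.1 x z.2) + (⁅x, z'.1⁆ + f.1 x z'.2)
      rw [lie_add, map_add]
      abel)
    (lie_add x z.2 z'.2)
  leibniz_lie x y z := Prod.ext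
    (by
      change ⁅x, ⁅y, z.1⁆ + f.1 y z.2⁆ + f.1 x ⁅y, z.2⁆ =
        (⁅⁅x, y⁆, z.1⁆ + f.1 ⁅x, y⁆ z.2) + (⁅y, ⁅x, z.1⁆ + f.1 x z.2⁆ + f.1 y ⁅x, z.2⁆)
      rw [LieModule.homCocycle.lie_apply, lie_add, lie_add, leibniz_lie x y z.1]
      abel)
    (leibniz_lie x y z.2)

instance : LieModule K L (CocycleModule f) where
  smul_lie t x z := Prod.ext
    (by
      change ⁅t • x, z.1⁆ + f.1 (t • x) z.2 = t • (⁅x, z.1⁆ + f.1 x z.2)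
      rw [smul_lie, map_smul, LinearMap.smul_apply, smul_add])
    (smul_lie t x z.2)
  lie_smul t x z := Prod.ext
    (by
      change ⁅x, t • z.1⁆ + f.1 x (t • z.2) = t • (⁅x, z.1⁆ + f.1 x z.2)
      rw [lie_smul, map_smul, smul_add])
    (lie_smul t x z.2)

end CocycleModule

/-! ### Extension classes as cocycles modulo coboundaries -/

namespace ModuleExtension

variable [Module.Finite K V] [Module.Finite K W]

/-- The extension of `V` by `W` that is defined by a cocycle. -/
def ofCocycle (f : LieModule.homCocycle K L V W) : ModuleExtension K L V W where
  E := CocycleModule f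
  incl :=
    { toFun := fun y => ((y, 0) : W × V)
      map_add' := fun y y' => Prod.ext rfl (add_zero 0).symm
      map_smul' := fun c y => Prod.ext rfl (smul_zero c).symm
      map_lie' := fun {x y} => Prod.ext
        (by
          change ⁅x, y⁆ = ⁅x, y⁆ + f.1 x 0
          rw [map_zero, add_zero])
        (lie_zero x).symm }
  proj :=
    { toFun := fun z => z.2
      map_add' := fun _ _ => rfl
      map_smul' := fun _ _ => rfl
      map_lie' := rfl }
  incl_injective := fun _ _ h => congrArg Prod.fst h
  exact := fun e => ⟨fun h => ⟨e.1, Prod.ext rfl h.symm⟩, by rintro ⟨y, rfl⟩; rfl⟩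
  proj_surjective := fun u => ⟨((0, u) : W × V), rfl⟩

/-- A linear map inducing the identity on both ends has the form `(w, u) ↦ (w + ψ u, u)`; its
compatibility with the action is the equation relating `f`, `g` and `ψ`. -/
theorem ofCocycle_equivalent_iff (f g : LieModule.homCocycle K L V W) :
    (ofCocycle f).Equivalent (ofCocycle g) ↔
      ∃ ψ : V →ₗ[K] W, ∀ x : L, f.1 x = g.1 x + ⁅x, ψ⁆ := by
  constructor
  · rintro ⟨ξ, h₁, h₂⟩
    let ψ : V →ₗ[K] W :=
      { toFun := fun u => (ξ ((0, u) : W × V) : W × V).1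
        map_add' := fun u u' => by
          have : ((0, u + u') : W × V) = ((0, u) : W × V) + ((0, u') : W × V) := by simp
          exact (congrArg (fun z => (ξ z : W × V).1) this).trans
            (congrArg Prod.fst (map_add ξ _ _))
        map_smul' := fun c u => by
          have : ((0, c • u) : W × V) = c • ((0, u) : W × V) := by simp
          exact (congrArg (fun z => (ξ z : W × V).1) this).trans
            (congrArg Prod.fst (map_smul ξ _ _)) }
    have hξ : ∀ z : W × V, ξ z = ((z.1 + ψ z.2, z.2) : W × V) := by
      intro z
      have hz : z = ((z.1, 0) : W × V) + ((0, z.2) : W × V) := by simp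
      have hadd := map_add ξ ((z.1, 0) : W × V) ((0, z.2) : W × V)
      refine (congrArg ξ hz).trans (hadd.trans (Prod.ext ?_ ?_))
      · have e1 : (ξ ((z.1, 0) : W × V) : W × V).1 = z.1 :=
          (congrArg Prod.fst (h₁ z.1) :)
        exact congrArg (· + ψ z.2) e1
      · exact (congrArg₂ (· + ·) (congrArg Prod.snd (h₁ z.1)) (h₂ ((0, z.2) : W × V))).trans
          (zero_add _)
    refine ⟨ψ, fun x => LinearMap.ext fun u => ?_⟩
    have h := ξ.map_lie x ((0, u) : W × V)
    have h' : ((⁅x, (0 : W)⁆ + f.1 x u) + ψ ⁅x, u⁆ : W) = ⁅x, 0 + ψ u⁆ + g.1 x u := by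
      have e1 := congrArg Prod.fst (hξ ((⁅x, (0 : W)⁆ + f.1 x u, ⁅x, u⁆) : W × V))
      have e2 := congrArg (fun z : W × V => ⁅x, z.1⁆ + g.1 x z.2) (hξ ((0, u) : W × V))
      exact e1.symm.trans ((congrArg Prod.fst h).trans e2)
    rw [lie_zero, zero_add, zero_add] at h'
    rw [LinearMap.add_apply, LieHom.lie_apply, eq_sub_of_add_eq h']
    abel
  · rintro ⟨ψ, hψ⟩
    refine ⟨{
      toFun := fun z => ((z.1 + ψ z.2, z.2) : W × V)
      map_add' := fun z z' => Prod.ext ?_ rfl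
      map_smul' := fun c z => Prod.ext ?_ rfl
      map_lie' := fun {x z} => Prod.ext ?_ rfl }, ?_, fun _ => rfl⟩
    · change z.1 + z'.1 + ψ (z.2 + z'.2) = z.1 + ψ z.2 + (z'.1 + ψ z'.2)
      rw [map_add]
      abel
    · change c • z.1 + ψ (c • z.2) = c • (z.1 + ψ z.2)
      rw [map_smul, smul_add]
    · change ⁅x, z.1⁆ + f.1 x z.2 + ψ ⁅x, z.2⁆ = ⁅x, z.1 + ψ z.2⁆ + g.1 x z.2
      rw [hψ, LinearMap.add_apply, LieHom.lie_apply, lie_add]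
      abel
    · intro y
      refine Prod.ext ?_ rfl
      change y + ψ 0 = y
      rw [map_zero, add_zero]

/-- Every extension is defined by a cocycle. -/
theorem exists_equivalent_ofCocycle (X : ModuleExtension K L V W) :
    ∃ f : LieModule.homCocycle K L V W, (ofCocycle f).Equivalent X := by
  obtain ⟨s, hs⟩ := (X.proj : X.E →ₗ[K] V).exists_rightInverse_of_surjective
    (LinearMap.range_eq_top.2 X.proj_surjective)
  replace hs : ∀ u, X.proj (s u) = u := fun u => LinearMap.congr_fun hs u
  -- The cocycle measures the failure of the linear section `s` to commute with the action.
  have hmem : ∀ (x : L) (u : V), ∃ y : W, X.incl y = ⁅x, s u⁆ - s ⁅x, u⁆ := fun x u =>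
    (X.exact _).1 (by rw [map_sub, LieModuleHom.map_lie, hs, hs, sub_self])
  choose F hF using hmem
  let f : L →ₗ[K] V →ₗ[K] W := LinearMap.mk₂ K F
    (fun x x' u => X.incl_injective (by simp only [map_add, hF, add_lie]; abel))
    (fun c x u => X.incl_injective (by simp only [map_smul, hF, smul_lie, smul_sub]))
    (fun x u u' => X.incl_injective (by simp only [map_add, hF, lie_add]; abel))
    (fun c x u => X.incl_injective (by simp only [map_smul, hF, lie_smul, smul_sub]))
  have hf : ∀ x u, X.incl (f x u) = ⁅x, s u⁆ - s ⁅x, u⁆ := hF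
  have hcoc : f ∈ LieModule.homCocycle K L V W := by
    intro x y
    ext u
    apply X.incl_injective
    simp only [LinearMap.sub_apply, LieHom.lie_apply, map_sub, LieModuleHom.map_lie, hf, lie_sub,
      lie_lie]
    abel
  refine ⟨⟨f, hcoc⟩, {
    toFun := fun z => X.incl z.1 + s z.2
    map_add' := fun z z' => ?_
    map_smul' := fun c z => ?_
    map_lie' := fun {x z} => ?_ }, fun y => ?_, fun z => ?_⟩
  · change X.incl (z.1 + z'.1) + s (z.2 + z'.2) = _
    rw [map_add, map_add]
    abel
  · change X.incl (c • z.1) + s (c • z.2) = _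
    rw [map_smul, map_smul, RingHom.id_apply, smul_add]
  · change X.incl (⁅x, z.1⁆ + f x z.2) + s ⁅x, z.2⁆ = ⁅x, X.incl z.1 + s z.2⁆
    rw [map_add, hf, LieModuleHom.map_lie, lie_add]
    abel
  · change X.incl y + s 0 = X.incl y
    rw [map_zero, add_zero]
  · change X.proj (X.incl z.1 + s z.2) = z.2
    rw [map_add, proj_incl, hs, zero_add]

/-- The map `((a, u), (b, u)) ↦ (a + b, u)` on the fibred product kills the antidiagonal and adds
the cocycles. -/
theorem baerSum_ofCocycle_equivalent (f g : LieModule.homCocycle K L V W) :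
    ((ofCocycle f).baerSum (ofCocycle g)).Equivalent (ofCocycle (f + g)) := by
  let p : (ofCocycle f).proj.fibredProduct (ofCocycle g).proj →ₗ[K] CocycleModule (f + g) :=
    { toFun := fun z => (((z.1.1 : W × V).1 + (z.1.2 : W × V).1, (z.1.1 : W × V).2) : W × V)
      map_add' := fun z z' => Prod.ext (add_add_add_comm _ _ _ _) rfl
      map_smul' := fun c z => Prod.ext (smul_add c _ _).symm rfl }
  refine ⟨{ ((ofCocycle f).antidiagonal (ofCocycle g)).toSubmodule.liftQ p ?_ with
    map_lie' := ?_ }, fun y => ?_, fun z => ?_⟩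
  · rintro z ⟨y, hy⟩
    rw [LinearMap.mem_ker]
    change (((z.1.1 : W × V).1 + (z.1.2 : W × V).1, (z.1.1 : W × V).2) : W × V) = 0
    rw [hy]
    exact Prod.ext (add_neg_cancel y) rfl
  · intro x z
    induction z using Submodule.Quotient.induction_on with
    | H z =>
      obtain ⟨⟨⟨a, u⟩, ⟨b, u'⟩⟩, hz⟩ := z
      obtain rfl : u = u' := hz
      refine Prod.ext ?_ rfl
      change (⁅x, a⁆ + f.1 x u) + (⁅x, b⁆ + g.1 x u) = ⁅x, a + b⁆ + (f.1 x u + g.1 x u)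
      rw [lie_add]
      abel
  · exact Prod.ext (add_zero y) rfl
  · induction z using Submodule.Quotient.induction_on with
    | H z => rfl

/-- In the pullback along `c • id`, the points are `((a, c • u), u)`, and `f x (c • u) = (c • f) x
u`. -/
theorem scalarMul_ofCocycle_equivalent (c : K) (f : LieModule.homCocycle K L V W) :
    ((ofCocycle f).scalarMul c).Equivalent (ofCocycle (c • f)) := by
  refine ⟨{
    toFun := fun z => (((z.1.1 : W × V).1, z.1.2) : W × V)
    map_add' := fun _ _ => rfl
    map_smul' := fun _ _ => rfl
    map_lie' := fun {x z} => Prod.ext ?_ rfl }, fun _ => rfl, fun _ => rfl⟩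
  obtain ⟨⟨⟨a, u⟩, u'⟩, hz⟩ := z
  obtain rfl : u = c • u' := hz
  change ⁅x, a⁆ + f.1 x (c • u') = ⁅x, a⁆ + c • f.1 x u'
  rw [map_smul]

end ModuleExtension

namespace YonedaExt

variable [Module.Finite K V] [Module.Finite K W]

/-- The class in `Ext¹(V, W)` of the extension that is defined by a cocycle. -/
def ofCocycle (f : LieModule.homCocycle K L V W) : YonedaExt K L V W :=
  Quotient.mk _ (ModuleExtension.ofCocycle f)

theorem ofCocycle_eq_iff (f g : LieModule.homCocycle K L V W) :
    ofCocycle f = ofCocycle g ↔ ∃ ψ : V →ₗ[K] W, ∀ x : L, f.1 x = g.1 x + ⁅x, ψ⁆ :=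
  Quotient.eq.trans (ModuleExtension.ofCocycle_equivalent_iff f g)

theorem ofCocycle_surjective :
    Function.Surjective (ofCocycle : LieModule.homCocycle K L V W → YonedaExt K L V W) := by
  intro X
  induction X using Quotient.inductionOn with
  | h X =>
    obtain ⟨f, hf⟩ := X.exists_equivalent_ofCocycle
    exact ⟨f, Quotient.sound hf⟩

theorem ofCocycle_add (f g : LieModule.homCocycle K L V W) :
    ofCocycle (f + g) = ofCocycle f + ofCocycle g :=
  (Quotient.sound (ModuleExtension.baerSum_ofCocycle_equivalent f g)).symm

theorem ofCocycle_smul (c : K) (f : LieModule.homCocycle K L V W) :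
    ofCocycle (c • f) = c • ofCocycle f :=
  (Quotient.sound (ModuleExtension.scalarMul_ofCocycle_equivalent c f)).symm

end YonedaExt

end Cocycle

/-! ### Extensions of evaluation modules -/

section EvaluationExt

variable {𝔤 : Type*} [LieRing 𝔤] [LieAlgebra ℂ 𝔤]
  {A : Type*} [CommRing A] [Algebra ℂ A] [Algebra.FiniteType ℂ A]
  (m : Ideal A) [m.IsMaximal]
  {V W : Type*}
  [AddCommGroup V] [Module ℂ V] [LieRingModule 𝔤 V] [LieModule ℂ 𝔤 V]
  [AddCommGroup W] [Module ℂ W] [LieRingModule 𝔤 W] [LieModule ℂ 𝔤 W]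

/-- The isomorphism `A / m ≃ ℂ`. -/
noncomputable def residueEquiv : (A ⧸ m) ≃ₐ[ℂ] ℂ :=
  (AlgEquiv.ofBijective (Algebra.ofId ℂ (A ⧸ m)) (algebraMap_quotient_bijective m)).symm

theorem residueEquiv_smul (a : A) (q : A ⧸ m) :
    residueEquiv m (a • q) = residue m a * residueEquiv m q := by
  rw [Algebra.smul_def, map_mul]
  rfl

/-- Holds because `V` and `W` are evaluated at the same `m`. Hence the coboundary of `ψ` is
determined by its restriction to `1 ⊗ 𝔤`. -/
theorem EvaluationModule.tmul_lie_hom (a : A) (x : 𝔤)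
    (ψ : EvaluationModule m V →ₗ[ℂ] EvaluationModule m W) :
    ⁅a ⊗ₜ[ℂ] x, ψ⁆ = residue m a • ⁅(1 : A) ⊗ₜ[ℂ] x, ψ⁆ := by
  have key (φ : V →ₗ[ℂ] W) (u : V) : ⁅residue m a • x, φ u⁆ - φ ⁅residue m a • x, u⁆ =
      residue m a • (⁅residue m 1 • x, φ u⁆ - φ ⁅residue m 1 • x, u⁆) := by
    simp [smul_sub]
  exact LinearMap.ext fun u => key ψ u

/-- The linear map `a ⊗ x ↦ (u ↦ D(a) h(x ⊗ u))`. -/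
noncomputable def evaluationCocycleAux (h : 𝔤 ⊗[ℂ] V →ₗ⁅ℂ, 𝔤⁆ W) (D : Derivation ℂ A (A ⧸ m)) :
    A ⊗[ℂ] 𝔤 →ₗ[ℂ] EvaluationModule m V →ₗ[ℂ] EvaluationModule m W :=
  TensorProduct.lift (((residueEquiv m).toLinearMap ∘ₗ (D : A →ₗ[ℂ] A ⧸ m)).smulRight
    (TensorProduct.curry (h : 𝔤 ⊗[ℂ] V →ₗ[ℂ] W)) : A →ₗ[ℂ] 𝔤 →ₗ[ℂ] V →ₗ[ℂ] W)

theorem LieModule.mem_homCocycle_of_tmul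
    (f : A ⊗[ℂ] 𝔤 →ₗ[ℂ] EvaluationModule m V →ₗ[ℂ] EvaluationModule m W)
    (hf : ∀ (a b : A) (x y : 𝔤), f ((a * b) ⊗ₜ ⁅x, y⁆) =
      ⁅a ⊗ₜ[ℂ] x, f (b ⊗ₜ y)⁆ - ⁅b ⊗ₜ[ℂ] y, f (a ⊗ₜ x)⁆) :
    f ∈ LieModule.homCocycle ℂ (A ⊗[ℂ] 𝔤) (EvaluationModule m V) (EvaluationModule m W) := by
  intro y z
  induction y using TensorProduct.induction_on with
  | zero => simp
  | add y₁ y₂ h₁ h₂ => rw [add_lie, map_add, map_add, add_lie, lie_add, h₁, h₂]; abel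
  | tmul a x =>
    induction z using TensorProduct.induction_on with
    | zero => simp
    | add z₁ z₂ h₁ h₂ => rw [lie_add, map_add, map_add, add_lie, lie_add, h₁, h₂]; abel
    | tmul b y => rw [LieAlgebra.ExtendScalars.bracket_tmul, hf]

theorem LieModuleHom.map_lie_tmul (h : 𝔤 ⊗[ℂ] V →ₗ⁅ℂ, 𝔤⁆ W) (x y : 𝔤) (u : V) :
    h (⁅x, y⁆ ⊗ₜ u) = ⁅x, h (y ⊗ₜ u)⁆ - h (y ⊗ₜ ⁅x, u⁆) := by
  rw [← LieModuleHom.map_lie, TensorProduct.LieModule.lie_tmul_right, map_add, add_sub_cancel_right]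

theorem LieModuleHom.ext_tmul {h h' : 𝔤 ⊗[ℂ] V →ₗ⁅ℂ, 𝔤⁆ W}
    (H : ∀ x u, h (x ⊗ₜ u) = h' (x ⊗ₜ u)) : h = h' := by
  have : (h : 𝔤 ⊗[ℂ] V →ₗ[ℂ] W) = h' := TensorProduct.ext' H
  ext z
  exact LinearMap.congr_fun this z

/-- Provides the finite basis of `Hom_𝔤(𝔤 ⊗ V, W)` that turns a derivation into this space into a
finite sum of pure tensors. -/
instance LieModuleHom.moduleFinite {K L M N : Type*} [Field K] [LieRing L] [LieAlgebra K L]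
    [AddCommGroup M] [Module K M] [LieRingModule L M] [LieModule K L M]
    [AddCommGroup N] [Module K N] [LieRingModule L N] [LieModule K L N]
    [Module.Finite K M] [Module.Finite K N] : Module.Finite K (M →ₗ⁅K, L⁆ N) :=
  Module.Finite.of_injective
    ({ toFun := fun f => f
       map_add' := fun _ _ => rfl
       map_smul' := fun _ _ => rfl } : (M →ₗ⁅K, L⁆ N) →ₗ[K] M →ₗ[K] N)
    fun _ _ h => LieModuleHom.ext (LinearMap.congr_fun h)

/-- The Leibniz rule splits `D(ab) h([x, y] ⊗ u)` into a term in `D b` and a term in `D a`.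
Equivariance of `h` under `x` accounts for the former, and under `y`, with `[y, x] = -[x, y]`, for
the latter. -/
theorem evaluationCocycleAux_mem (h : 𝔤 ⊗[ℂ] V →ₗ⁅ℂ, 𝔤⁆ W) (D : Derivation ℂ A (A ⧸ m)) :
    evaluationCocycleAux m h D ∈
      LieModule.homCocycle ℂ (A ⊗[ℂ] 𝔤) (EvaluationModule m V) (EvaluationModule m W) := by
  refine LieModule.mem_homCocycle_of_tmul m _ fun a b x y => LinearMap.ext fun (u : V) => ?_
  change (residueEquiv m (D (a * b)) • h (⁅x, y⁆ ⊗ₜ u) : W) =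
    (⁅residue m a • x, residueEquiv m (D b) • h (y ⊗ₜ u)⁆ -
      residueEquiv m (D b) • h (y ⊗ₜ ⁅residue m a • x, u⁆)) -
    (⁅residue m b • y, residueEquiv m (D a) • h (x ⊗ₜ u)⁆ -
      residueEquiv m (D a) • h (x ⊗ₜ ⁅residue m b • y, u⁆))
  have h₁ := LieModuleHom.map_lie_tmul h x y u
  have h₂ := LieModuleHom.map_lie_tmul h y x u
  rw [← lie_skew, TensorProduct.neg_tmul, map_neg] at h₂
  rw [Derivation.leibniz, map_add, residueEquiv_smul, residueEquiv_smul]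
  simp only [smul_lie, lie_smul, TensorProduct.tmul_smul, map_smul]
  rw [eq_add_of_sub_eq h₁.symm, eq_add_of_sub_eq h₂.symm]
  module

/-- The cocycle that is defined by an element of `Hom_𝔤(𝔤 ⊗ V, W) ⊗ Der(A, A / m)`. -/
noncomputable def evaluationCocycle :
    (𝔤 ⊗[ℂ] V →ₗ⁅ℂ, 𝔤⁆ W) ⊗[ℂ] Derivation ℂ A (A ⧸ m) →ₗ[ℂ]
      LieModule.homCocycle ℂ (A ⊗[ℂ] 𝔤) (EvaluationModule m V) (EvaluationModule m W) :=
  TensorProduct.lift (LinearMap.mk₂ ℂ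
    (fun h D => ⟨evaluationCocycleAux m h D, evaluationCocycleAux_mem m h D⟩)
    (fun h h' D => Subtype.ext (TensorProduct.ext' fun a x => LinearMap.ext fun (u : V) =>
      smul_add (residueEquiv m (D a)) (h (x ⊗ₜ u)) (h' (x ⊗ₜ u))))
    (fun c h D => Subtype.ext (TensorProduct.ext' fun a x => LinearMap.ext fun (u : V) =>
      smul_comm (residueEquiv m (D a)) c (h (x ⊗ₜ u))))
    (fun h D D' => Subtype.ext (TensorProduct.ext' fun a x => LinearMap.ext fun (u : V) => by
      change (residueEquiv m (D a + D' a) • h (x ⊗ₜ u) : W) =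
        residueEquiv m (D a) • h (x ⊗ₜ u) + residueEquiv m (D' a) • h (x ⊗ₜ u)
      rw [map_add, add_smul]))
    (fun c h D => Subtype.ext (TensorProduct.ext' fun a x => LinearMap.ext fun (u : V) => by
      change (residueEquiv m (c • D a) • h (x ⊗ₜ u) : W) =
        c • residueEquiv m (D a) • h (x ⊗ₜ u)
      rw [map_smul, smul_assoc])))

/-- The linear map `h ⊗ D ↦ D(a) h`. -/
noncomputable def evaluateDerivation (a : A) :
    (𝔤 ⊗[ℂ] V →ₗ⁅ℂ, 𝔤⁆ W) ⊗[ℂ] Derivation ℂ A (A ⧸ m) →ₗ[ℂ] (𝔤 ⊗[ℂ] V →ₗ⁅ℂ, 𝔤⁆ W) :=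
  TensorProduct.lift (LinearMap.mk₂ ℂ (fun h D => residueEquiv m (D a) • h)
    (fun h h' D => smul_add _ _ _)
    (fun c h D => smul_comm _ _ _)
    (fun h D D' => by rw [Derivation.add_apply, map_add, add_smul])
    (fun c h D => by rw [Derivation.smul_apply, map_smul, smul_assoc]))

/-! ### Recovering a tensor from its cocycle -/

theorem evaluationCocycle_tmul (t : (𝔤 ⊗[ℂ] V →ₗ⁅ℂ, 𝔤⁆ W) ⊗[ℂ] Derivation ℂ A (A ⧸ m))
    (a : A) (x : 𝔤) (u : V) :
    (evaluationCocycle m t).1 (a ⊗ₜ x) u = (evaluateDerivation m a t (x ⊗ₜ u) : W) := by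
  induction t using TensorProduct.induction_on with
  | zero => rw [map_zero, map_zero]; rfl
  | add t t' h h' => rw [map_add, map_add]; exact congrArg₂ (· + ·) h h'
  | tmul h D => rfl

theorem evaluateDerivation_one (t : (𝔤 ⊗[ℂ] V →ₗ⁅ℂ, 𝔤⁆ W) ⊗[ℂ] Derivation ℂ A (A ⧸ m)) :
    evaluateDerivation m 1 t = 0 := by
  induction t using TensorProduct.induction_on with
  | zero => rw [map_zero]
  | add t t' h h' => rw [map_add, h, h', add_zero]
  | tmul h D =>
    change residueEquiv m (D 1) • h = 0
    rw [Derivation.map_one_eq_zero, map_zero, zero_smul]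

theorem evaluationCocycle_one_tmul (t : (𝔤 ⊗[ℂ] V →ₗ⁅ℂ, 𝔤⁆ W) ⊗[ℂ] Derivation ℂ A (A ⧸ m))
    (x : 𝔤) : (evaluationCocycle m t).1 (1 ⊗ₜ x) = 0 := by
  refine LinearMap.ext fun (u : V) => (evaluationCocycle_tmul m t 1 x u).trans ?_
  rw [evaluateDerivation_one]
  rfl

/-- In a basis of `Hom_𝔤(𝔤 ⊗ V, W)` the coefficients of `t` are derivations, and their values at `a`
are the coordinates of `evaluateDerivation m a t`, which the cocycle determines. -/
theorem evaluationCocycle_injective :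
    Function.Injective (evaluationCocycle m : (𝔤 ⊗[ℂ] V →ₗ⁅ℂ, 𝔤⁆ W) ⊗[ℂ] _ →ₗ[ℂ] _) := by
  rw [injective_iff_map_eq_zero]
  intro t ht
  have hev : ∀ a, evaluateDerivation m a t = 0 := by
    intro a
    refine LieModuleHom.ext_tmul fun x u => (evaluationCocycle_tmul m t a x u).symm.trans ?_
    rw [ht]
    rfl
  let b := Module.Free.chooseBasis ℂ (𝔤 ⊗[ℂ] V →ₗ⁅ℂ, 𝔤⁆ W)
  have key : ∀ (t : (𝔤 ⊗[ℂ] V →ₗ⁅ℂ, 𝔤⁆ W) ⊗[ℂ] Derivation ℂ A (A ⧸ m)) (a : A) i,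
      b.repr (evaluateDerivation m a t) i =
        residueEquiv m (TensorProduct.equivFinsuppOfBasisLeft b t i a) := by
    intro t a i
    induction t using TensorProduct.induction_on with
    | zero => simp
    | add t t' h h' => simp [h, h']
    | tmul h D =>
      rw [TensorProduct.equivFinsuppOfBasisLeft_apply_tmul_apply, Derivation.smul_apply, map_smul]
      change b.repr (residueEquiv m (D a) • h) i = _
      simp [mul_comm]
  apply (TensorProduct.equivFinsuppOfBasisLeft b).injective
  rw [map_zero]
  ext i a
  apply (residueEquiv m).injective
  rw [← key, hev, map_zero]
  simp

/-! ### Normalised cocycles are derivations, for semisimple 𝔤 -/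

variable [Module.Finite ℂ 𝔤] [LieAlgebra.IsSemisimple ℂ 𝔤] [Module.Finite ℂ V] [Module.Finite ℂ W]

theorem exists_evaluationCocycle_eq
    (f : LieModule.homCocycle ℂ (A ⊗[ℂ] 𝔤) (EvaluationModule m V) (EvaluationModule m W))
    (hf : ∀ x : 𝔤, f.1 (1 ⊗ₜ x) = 0) :
    ∃ t : (𝔤 ⊗[ℂ] V →ₗ⁅ℂ, 𝔤⁆ W) ⊗[ℂ] Derivation ℂ A (A ⧸ m), evaluationCocycle m t = f := by
  let f' : A →ₗ[ℂ] 𝔤 →ₗ[ℂ] V →ₗ[ℂ] W := TensorProduct.curry f.1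
  have hcoc : ∀ (a b : A) (x y : 𝔤) (u : V), f' (a * b) ⁅x, y⁆ u =
      (residue m a • ⁅x, f' b y u⁆ - residue m a • f' b y ⁅x, u⁆) -
        (residue m b • ⁅y, f' a x u⁆ - residue m b • f' a x ⁅y, u⁆) := by
    intro a b x y u
    have h := LieModule.homCocycle.lie_apply f (a ⊗ₜ x) (b ⊗ₜ y) u
    rw [LieAlgebra.ExtendScalars.bracket_tmul] at h
    refine Eq.trans h ?_
    change (⁅residue m a • x, f' b y u⁆ - f' b y ⁅residue m a • x, u⁆) -
      (⁅residue m b • y, f' a x u⁆ - f' a x ⁅residue m b • y, u⁆) = _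
    simp only [smul_lie, map_smul]
  have hf' : ∀ x, f' 1 x = 0 := hf
  have hequiv : ∀ (a : A) (x y : 𝔤) (u : V), f' a ⁅x, y⁆ u = ⁅x, f' a y u⁆ - f' a y ⁅x, u⁆ := by
    intro a x y u
    -- With first ring element 1, the terms containing `f' 1` vanish and the residue is 1.
    simpa [hf'] using hcoc 1 a x y u
  have hmul : ∀ a b : A, f' (a * b) = residue m a • f' b + residue m b • f' a := by
    intro a b
    rw [← sub_eq_zero]
    -- The cocycle identity controls only brackets; perfectness of `𝔤` extends the product rule to
    -- all of it.
    refine LieAlgebra.HasTrivialRadical.linearMap_eq_zero_of_lie _ fun x y => ?_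
    ext u
    have h₁ := hequiv b x y u
    have h₂ := hequiv a y x u
    rw [← lie_skew, map_neg, LinearMap.neg_apply] at h₂
    simp only [LinearMap.sub_apply, LinearMap.add_apply, LinearMap.smul_apply, hcoc,
      LinearMap.zero_apply]
    rw [eq_add_of_sub_eq h₁.symm, eq_add_of_sub_eq h₂.symm]
    module
  let F : A →ₗ[ℂ] (𝔤 ⊗[ℂ] V →ₗ⁅ℂ, 𝔤⁆ W) :=
    { toFun := fun a => TensorProduct.LieModule.liftLie ℂ 𝔤 𝔤 V W
        { f' a with
          map_lie' := fun {x y} => by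
            ext u
            exact (hequiv a x y u).trans (LieHom.lie_apply _ _ _).symm }
      map_add' := fun a b => LieModuleHom.ext_tmul fun x u => by
        change f' (a + b) x u = f' a x u + f' b x u
        rw [map_add, LinearMap.add_apply, LinearMap.add_apply]
      map_smul' := fun c a => LieModuleHom.ext_tmul fun x u => by
        change f' (c • a) x u = c • f' a x u
        rw [map_smul, LinearMap.smul_apply, LinearMap.smul_apply] }
  have hF : ∀ a x u, F a (x ⊗ₜ u) = f' a x u := fun a x u => rfl
  have hFmul : ∀ a b, F (a * b) = residue m a • F b + residue m b • F a := by
    intro a b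
    refine LieModuleHom.ext_tmul fun x u => ?_
    change f' (a * b) x u = residue m a • f' b x u + residue m b • f' a x u
    rw [hmul]
    rfl
  let b := Module.finBasis ℂ (𝔤 ⊗[ℂ] V →ₗ⁅ℂ, 𝔤⁆ W)
  -- The coordinates of `F`, transported from `ℂ` to `A ⧸ m`; `hFmul` is their Leibniz rule.
  let D : Fin (Module.finrank ℂ (𝔤 ⊗[ℂ] V →ₗ⁅ℂ, 𝔤⁆ W)) → Derivation ℂ A (A ⧸ m) := fun i =>
    Derivation.mk' ((residueEquiv m).symm.toLinearMap ∘ₗ b.coord i ∘ₗ F) fun a a' => by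
      apply (residueEquiv m).injective
      rw [map_add, residueEquiv_smul, residueEquiv_smul]
      simp [hFmul]
  have hD : ∀ i a, residueEquiv m (D i a) = b.repr (F a) i := fun i a =>
    (residueEquiv m).apply_symm_apply _
  refine ⟨∑ i, b i ⊗ₜ D i, Subtype.ext (TensorProduct.ext' fun a x =>
    LinearMap.ext fun (u : V) => (evaluationCocycle_tmul m _ a x u).trans ?_)⟩
  have : evaluateDerivation m a (∑ i, b i ⊗ₜ D i) = F a := by
    rw [map_sum]
    conv_rhs => rw [← b.sum_repr (F a)]
    exact Finset.sum_congr rfl fun i _ => congrArg (· • b i) (hD i a)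
  rw [this]
  rfl

/-- Every cocycle is cohomologous to one that vanishes on `𝔤`. -/
theorem exists_homCocycle_one_tmul_eq_zero
    (f : LieModule.homCocycle ℂ (A ⊗[ℂ] 𝔤) (EvaluationModule m V) (EvaluationModule m W)) :
    ∃ (g : LieModule.homCocycle ℂ (A ⊗[ℂ] 𝔤) (EvaluationModule m V) (EvaluationModule m W))
      (ψ : EvaluationModule m V →ₗ[ℂ] EvaluationModule m W),
      (∀ x, g.1 x = f.1 x + ⁅x, ψ⁆) ∧ ∀ x : 𝔤, g.1 (1 ⊗ₜ x) = 0 := by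
  let f₀ : 𝔤 →ₗ[ℂ] V →ₗ[ℂ] W := TensorProduct.curry f.1 1
  have hlie : ∀ (x : 𝔤) (φ : EvaluationModule m V →ₗ[ℂ] EvaluationModule m W),
      ⁅(1 : A) ⊗ₜ[ℂ] x, φ⁆ = (⁅x, (show V →ₗ[ℂ] W from φ)⁆ : V →ₗ[ℂ] W) := by
    intro x φ
    have key (φ : V →ₗ[ℂ] W) (u : V) : ⁅residue m 1 • x, φ u⁆ - φ ⁅residue m 1 • x, u⁆ =
        (⁅x, φ⁆ : V →ₗ[ℂ] W) u := by
      simp [LieHom.lie_apply]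
    exact LinearMap.ext fun u => key φ u
  obtain ⟨ψ, hψ⟩ := LieModule.exists_lie_eq_of_cocycle f₀ (fun x y => by
    have h := f.2 (1 ⊗ₜ x) (1 ⊗ₜ y)
    rw [LieAlgebra.ExtendScalars.bracket_tmul, one_mul, hlie, hlie] at h
    exact h)
  -- The sign makes the coboundary of `ψ'` cancel `f` on `1 ⊗ 𝔤`.
  let ψ' : EvaluationModule m V →ₗ[ℂ] EvaluationModule m W := -ψ
  let δ : A ⊗[ℂ] 𝔤 →ₗ[ℂ] EvaluationModule m V →ₗ[ℂ] EvaluationModule m W :=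
    { toFun := fun x => ⁅x, ψ'⁆
      map_add' := fun x y => add_lie x y ψ'
      map_smul' := fun c x => smul_lie c x ψ' }
  refine ⟨⟨f.1 + δ, Submodule.add_mem _ f.2 fun x y => lie_lie x y ψ'⟩, ψ', fun x => rfl,
    fun x => ?_⟩
  have h₁ : f.1 (1 ⊗ₜ x) = (⁅x, ψ⁆ : V →ₗ[ℂ] W) := hψ x
  change f.1 (1 ⊗ₜ x) + ⁅(1 : A) ⊗ₜ[ℂ] x, ψ'⁆ = 0
  rw [hlie, h₁]
  exact (congrArg (⁅x, ψ⁆ + ·) (lie_neg x ψ)).trans (add_neg_cancel _)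

theorem YonedaExt.bijective_ofCocycle_evaluationCocycle :
    Function.Bijective fun t : (𝔤 ⊗[ℂ] V →ₗ⁅ℂ, 𝔤⁆ W) ⊗[ℂ] Derivation ℂ A (A ⧸ m) =>
      letI : Module.Finite ℂ (EvaluationModule m V) := inferInstanceAs (Module.Finite ℂ V)
      letI : Module.Finite ℂ (EvaluationModule m W) := inferInstanceAs (Module.Finite ℂ W)
      YonedaExt.ofCocycle (evaluationCocycle m t) := by
  let _ : Module.Finite ℂ (EvaluationModule m V) := inferInstanceAs (Module.Finite ℂ V)
  let _ : Module.Finite ℂ (EvaluationModule m W) := inferInstanceAs (Module.Finite ℂ W)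
  constructor
  · intro t t' h
    obtain ⟨ψ, hψ⟩ := (YonedaExt.ofCocycle_eq_iff _ _).1 h
    -- Both cocycles vanish on `1 ⊗ 𝔤`, since derivations kill 1; so the coboundary of `ψ` vanishes
    -- there, and then everywhere.
    have hψ0 : ∀ x : 𝔤, ⁅(1 : A) ⊗ₜ[ℂ] x, ψ⁆ = 0 := by
      intro x
      have := hψ (1 ⊗ₜ x)
      rwa [evaluationCocycle_one_tmul, evaluationCocycle_one_tmul, zero_add, eq_comm] at this
    refine evaluationCocycle_injective m (Subtype.ext (TensorProduct.ext' fun a x => ?_))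
    rw [hψ, EvaluationModule.tmul_lie_hom, hψ0, smul_zero, add_zero]
  · intro X
    obtain ⟨f, rfl⟩ := YonedaExt.ofCocycle_surjective X
    obtain ⟨g, ψ, hg, hg0⟩ := exists_homCocycle_one_tmul_eq_zero m f
    obtain ⟨t, rfl⟩ := exists_evaluationCocycle_eq m g hg0
    exact ⟨t, (YonedaExt.ofCocycle_eq_iff _ _).2 ⟨ψ, hg⟩⟩

end EvaluationExt

theorem proposition3
    {𝔤 : Type*} [LieRing 𝔤] [LieAlgebra ℂ 𝔤] [Module.Finite ℂ 𝔤] [LieAlgebra.IsSemisimple ℂ 𝔤]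
    (H : LieSubalgebra ℂ 𝔤) [H.IsCartanSubalgebra] (b : (LieAlgebra.IsKilling.rootSystem H).Base)
    {A : Type*} [CommRing A] [Algebra ℂ A] [Algebra.FiniteType ℂ A]
    (m : Ideal A) [m.IsMaximal]
    (lam mu : Module.Dual ℂ H) (hlam : IsDominantWeight b lam) (hmu : IsDominantWeight b mu)
    {V W : Type*}
    [AddCommGroup V] [Module ℂ V] [LieRingModule 𝔤 V] [LieModule ℂ 𝔤 V]
    [AddCommGroup W] [Module ℂ W] [LieRingModule 𝔤 W] [LieModule ℂ 𝔤 W]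
    (hV : IsSimpleOfHighestWeight b lam V) (hW : IsSimpleOfHighestWeight b mu W) :
    ∃ e : YonedaExt ℂ (A ⊗[ℂ] 𝔤) (EvaluationModule m V) (EvaluationModule m W) ≃
        (𝔤 ⊗[ℂ] V →ₗ⁅ℂ, 𝔤⁆ W) ⊗[ℂ] Derivation ℂ A (A ⧸ m),
      (∀ X Y, e (X + Y) = e X + e Y) ∧ ∀ (c : ℂ) (X), e (c • X) = c • e X := by
  have := hV.finite
  have := hW.finite
  let _ : Module.Finite ℂ (EvaluationModule m V) := inferInstanceAs (Module.Finite ℂ V)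
  let _ : Module.Finite ℂ (EvaluationModule m W) := inferInstanceAs (Module.Finite ℂ W)
  let φ := Equiv.ofBijective _
    (YonedaExt.bijective_ofCocycle_evaluationCocycle (𝔤 := 𝔤) m (V := V) (W := W))
  have hφ : ∀ t, φ t = YonedaExt.ofCocycle (evaluationCocycle m t) := fun _ => rfl
  refine ⟨φ.symm, fun X Y => ?_, fun c X => ?_⟩
  · apply φ.injective
    rw [φ.apply_symm_apply, hφ, map_add, YonedaExt.ofCocycle_add, ← hφ, ← hφ, φ.apply_symm_apply,
      φ.apply_symm_apply]
  · apply φ.injective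
    rw [φ.apply_symm_apply, hφ, map_smul, YonedaExt.ofCocycle_smul, ← hφ, φ.apply_symm_apply]
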